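/- A machine is in state $0$ (free), $1$ (busy with an internal job) or $2$ (busy with an external job). Let $X(t)$ be its state and $\hat X(t)$ a monitor's estimate of it. Let $\alpha,\beta,\gamma,\lambda>0$ and $\mu\ge 0$. A free machine receives internal jobs at rate $\alpha$; internal jobs are completed at rate $\beta$, external jobs at rate $\gamma$. The monitor samples the machine at rate $\mu$, and then $\hat X$ becomes $X$. External jobs arrive at the monitor at rate $\lambda$; they are rejected if $\hat X\neq 0$. If $\hat X=0$, the job is sent to the machine: if $X=0$, then $(X,\hat X)$ becomes $(2,2)$; if $X=1$, then the job is lost and $(X,\hat X)$ becomes $(1,1)$. Thus $Y(t)=(X(t),\hat X(t))$ is a continuous-time Markov chain on $S=\{0,1\}\times\{0,1\}\cup\{0,1,2\}\times\{2\}$, started at $Y(0)=(0,0)$. Let $C(0,0)=C(1,1)=C(1,2)=C(2,2)=1$ and $C=0$ on the other states (states $1$ and $2$ are deemed equivalent), and let $$\Delta=\limsup_{T\to\infty}\frac1T\int_0^T C(X(t),\hat X(t))\,dt .$$ **Theorem.** For every $\mu>0$ the chain has a unique stationary distribution $\pi^{(\mu)}$. When $\mu=0$, the average freshness $\mathbb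 E[\Delta]$ (with $\Delta$ integrable) is the limit of the formula for $\mu>0$: $$\mathbb E[\Delta]=\lim_{\mu\to0^+}\left(1-\bigl(\pi^{(\mu)}_{10}+\pi^{(\mu)}_{01}+\pi^{(\mu)}_{02}\bigr)\right)=\frac{\alpha}{\alpha+\beta}.$$ Moreover, when $\mu=0$, the chain almost surely leaves the pair of transient states $\{(0,0),(1,0)\}$; for each $s$ in this pair, the event that it first leaves the pair from $s$ has positive probability, and the conditional expectation of $\Delta$ given this event is $\frac{\alpha}{\alpha+\beta}$. -/

import Mathlib

open MeasureTheory ProbabilityTheory Filter Topology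

noncomputable section

/-! ### Continuous-time Markov chains on a finite state space -/

section CTMC

variable {S : Type*} [Fintype S] [DecidableEq S]

/-- The generator matrix with off-diagonal entries `r i j` (the rate of transition from `i` to `j`);
each diagonal entry makes its row sum to zero. The values `r i i` are ignored. -/
def generatorOf (r : S → S → ℝ) : Matrix S S ℝ :=
  fun i j => if i = j then -∑ k ∈ Finset.univ.erase i, r i k else r i j

/-- Total rate of transition out of the state `i`. -/
def exitRate (Q : Matrix S S ℝ) (i : S) : ℝ := -Q i i

/-- Transition matrix of the embedded discrete-time chain of `Q`
(a state with exit rate `0` is absorbing). -/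
def embeddedMatrix (Q : Matrix S S ℝ) : Matrix S S ℝ :=
  fun i j =>
    if exitRate Q i = 0 then (if i = j then 1 else 0)
    else (if i = j then 0 else Q i j / exitRate Q i)

/-- `π` is a stationary distribution of the chain with generator `Q`. -/
def IsStationaryDistr (Q : Matrix S S ℝ) (π : S → ℝ) : Prop :=
  (∀ i, 0 ≤ π i) ∧ ∑ i, π i = 1 ∧ Matrix.vecMul π Q = 0

/-- Time of the `n`-th jump, when the successive states are `Z 0, Z 1, …` and the `k`-th holding
time is `E k` divided by the exit rate of `Z k`. -/
def jumpTime {Ω : Type*} (Q : Matrix S S ℝ) (Z : ℕ → Ω → S) (E : ℕ → Ω → ℝ) (n : ℕ) (ω : Ω) : ℝ :=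
  ∑ k ∈ Finset.range n, E k ω / exitRate Q (Z k ω)

/-- The process `Y` is the jump-and-hold process with embedded chain `Z` and holding times
`E k / exitRate Q (Z k)`, where `Z` is a discrete-time Markov chain started at `x₀` with transition
matrix `embeddedMatrix Q`, and the `E k` are i.i.d. standard exponential and independent of `Z`.
That is, given `Z`, the holding times are independent and exponential with the exit rates of the
visited states as parameters. -/
structure IsJumpHold {Ω : Type*} [MeasurableSpace Ω] [MeasurableSpace S] (P : Measure Ω)
    (Q : Matrix S S ℝ) (x₀ : S) (Z : ℕ → Ω → S) (E : ℕ → Ω → ℝ) (Y : ℝ → Ω → S) : Prop where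
  measurable_chain : ∀ n, Measurable (Z n)
  measurable_clock : ∀ n, Measurable (E n)
  /-- Law of the embedded chain. -/
  chain_law : ∀ (n : ℕ) (z : ℕ → S),
    P.real {ω | ∀ k ≤ n, Z k ω = z k} =
      (if z 0 = x₀ then 1 else 0) * ∏ k ∈ Finset.range n, embeddedMatrix Q (z k) (z (k + 1))
  clock_law : ∀ n, P.map (E n) = expMeasure 1
  clock_indep : iIndepFun E P
  clock_indep_chain : IndepFun (fun ω n => E n ω) (fun ω n => Z n ω) P
  /-- From the `n`-th jump time on, for the `n`-th holding time, the process sits at `Z n`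
  (forever if the exit rate of `Z n` is zero). -/
  path : ∀ᵐ ω ∂P, ∀ (n : ℕ) (t : ℝ), jumpTime Q Z E n ω ≤ t →
    (t - jumpTime Q Z E n ω) * exitRate Q (Z n ω) < E n ω → Y t ω = Z n ω

/-- `(Y t)`, `t ≥ 0`, is a continuous-time Markov chain with generator `Q` started at `x₀`. -/
def IsCTMC {Ω : Type*} [MeasurableSpace Ω] [MeasurableSpace S] (P : Measure Ω)
    (Q : Matrix S S ℝ) (x₀ : S) (Y : ℝ → Ω → S) : Prop :=
  (∀ t, 0 ≤ t → Measurable (Y t)) ∧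
    ∃ (Z : ℕ → Ω → S) (E : ℕ → Ω → ℝ), IsJumpHold P Q x₀ Z E Y

end CTMC

/-- The event that the process `Y` leaves the set `D` for the first time from the state `s`: up to
some time `τ > 0` it stays in `D`, at `τ` it is outside `D`, and it is at `s` just before `τ`. -/
def exitsFrom {Ω S : Type*} (D : Set S) (Y : ℝ → Ω → S) (s : S) : Set Ω :=
  {ω | ∃ τ : ℝ, 0 < τ ∧ (∀ t, 0 ≤ t → t < τ → Y t ω ∈ D) ∧ Y τ ω ∉ D ∧
    ∀ᶠ t in 𝓝[<] τ, Y t ω = s}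

/-- Long-run fraction of time during which the estimate is fresh, for the similarity map `C`. -/
def freshness {Ω S : Type*} (C : S → ℝ) (Y : ℝ → Ω → S) (ω : Ω) : ℝ :=
  limsup (fun T : ℝ => (1 / T) * ∫ t in (0 : ℝ)..T, C (Y t ω)) atTop

/-- The average freshness `𝔼[Δ]`. -/
def avgFreshness {Ω S : Type*} [MeasurableSpace Ω] (P : Measure Ω) (C : S → ℝ)
    (Y : ℝ → Ω → S) : ℝ :=
  ∫ ω, freshness C Y ω ∂P

/-! ### The Markov machine and its monitor -/

/-- States `(x, x̂)`: the actual state `x` of the machine (`0` free, `1` busy with an internal job,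
`2` busy with an external job) and the estimate `x̂`; the set is
`{0,1} × {0,1} ∪ {0,1,2} × {2}`. -/
abbrev MonState : Type := {p : Fin 3 × Fin 3 // p.2 = 2 ∨ p.1 ≠ 2}

/-- The rate of transition from `i` to `j ≠ i`, as a sum over the events that can occur:
an internal job arrives at a free machine (rate `α`), an internal job is completed (rate `β`),
an external job is completed (rate `γ`), the machine is sampled and the estimate becomes the actual
state (rate `μ`), an external job arrives (rate `lam`) when the estimate is `0` and so is sent to
the machine: it is processed if the machine is free, it is lost if the machine is busy, and in both
cases the estimate becomes the resulting actual state. -/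
def monRate (α β γ lam μ : ℝ) (i j : MonState) : ℝ :=
  (if i.1.1 = 0 ∧ j.1 = (1, i.1.2) then α else 0)
  + (if i.1.1 = 1 ∧ j.1 = (0, i.1.2) then β else 0)
  + (if i.1.1 = 2 ∧ j.1 = (0, i.1.2) then γ else 0)
  + (if j.1 = (i.1.1, i.1.1) then μ else 0)
  + (if i.1.2 = 0 ∧ j.1 = (if i.1.1 = 0 then (2, 2) else (i.1.1, i.1.1)) then lam else 0)

/-- Generator of `Y(t) = (X(t), X̂(t))`. -/
def monGen (α β γ lam μ : ℝ) : Matrix MonState MonState ℝ :=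
  generatorOf (monRate α β γ lam μ)

def s00 : MonState := ⟨(0, 0), by decide⟩
def s10 : MonState := ⟨(1, 0), by decide⟩
def s01 : MonState := ⟨(0, 1), by decide⟩
def s02 : MonState := ⟨(0, 2), by decide⟩

/-- The special similarity map:
`C(0,0) = C(1,1) = C(1,2) = C(2,2) = 1`, and zero otherwise. -/
def specialMap (i : MonState) : ℝ :=
  if i.1 = (0, 0) ∨ i.1 = (1, 1) ∨ i.1 = (1, 2) ∨ i.1 = (2, 2) then 1 else 0

end

/-! When `μ = 0` the estimate changes only at an external arrival that finds it equal to 0, and it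
never returns to 0. Each round trip between (0,0) and (1,0) has probability less than 1, so the
chain almost surely leaves the pair (`IsJumpHold.ae_ne_pairChain`): from (0,0) to (2,2), or from
(1,0) to (1,1). It then ends up in one of the closed classes {(0,2), (1,2)} and {(0,1), (1,1)}. In
both it alternates between a stale free state of rate `α` and a fresh busy state of rate `β`. By the
strong law for the clocks, the fresh fraction of time is (1/β)/(1/α + 1/β) = α/(α+β)
(`freshness_eq_of_alternating`, resting on `tendsto_time_average_step`).

Thus Δ is almost surely constant (`IsJumpHold.ae_exit_and_freshness`), which gives integrability,
the mean and both conditional means at once.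

For `μ > 0` the balance equations have a one-dimensional solution space, spanned by the explicit
`monWeight` (`IsStationaryDistr.eq_monWeight`). These weights extend continuously to `μ = 0`, where
they vanish off the two closed classes and each busy weight is α/β times its free partner. The fresh
share therefore tends to α/(α+β) (`tendsto_stationary_freshness`). -/

lemma generatorOf_apply_ne {S : Type*} [Fintype S] [DecidableEq S] (r : S → S → ℝ) {i j : S}
    (h : i ≠ j) : generatorOf r i j = r i j := by
  simp [generatorOf, h]

lemma exitRate_generatorOf {S : Type*} [Fintype S] [DecidableEq S] (r : S → S → ℝ) (i : S) :
    exitRate (generatorOf r) i = ∑ k, r i k - r i i := by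
  rw [exitRate, generatorOf, if_pos rfl, neg_neg,
    ← Finset.add_sum_erase Finset.univ (r i) (Finset.mem_univ i), add_sub_cancel_left]

/-- The ignored diagonal rate `r j j` occurs in both sums and cancels, so neither sum has to omit
it. -/
lemma vecMul_generatorOf {S : Type*} [Fintype S] [DecidableEq S] (r : S → S → ℝ) (π : S → ℝ)
    (j : S) :
    Matrix.vecMul π (generatorOf r) j = ∑ i, π i * r i j - π j * ∑ k, r j k := by
  have h : ∀ i, generatorOf r i j = r i j - if i = j then ∑ k, r j k else 0 := by
    intro i
    by_cases hij : i = j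
    · subst hij
      rw [if_pos rfl, ← neg_sub, ← exitRate_generatorOf, exitRate, neg_neg]
    · simp [generatorOf, hij]
  simp [Matrix.vecMul, dotProduct, h, mul_sub, Finset.sum_sub_distrib]

/-! ### Stationary distributions with sampling -/

def s11 : MonState := ⟨(1, 1), by decide⟩
def s12 : MonState := ⟨(1, 2), by decide⟩
def s22 : MonState := ⟨(2, 2), by decide⟩

lemma univ_monState : (Finset.univ : Finset MonState) = {s00, s10, s01, s11, s02, s12, s22} := by
  decide

lemma sum_monState (f : MonState → ℝ) :
    ∑ k, f k = f s00 + f s10 + f s01 + f s11 + f s02 + f s12 + f s22 := by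
  rw [univ_monState]
  repeat rw [Finset.sum_insert (by decide)]
  rw [Finset.sum_singleton]
  ring

lemma forall_monState {p : MonState → Prop} : (∀ i, p i) ↔
    p s00 ∧ p s10 ∧ p s01 ∧ p s11 ∧ p s02 ∧ p s12 ∧ p s22 := by
  have h : ∀ i : MonState, i ∈ ({s00, s10, s01, s11, s02, s12, s22} : Finset MonState) := by
    rw [← univ_monState]; exact Finset.mem_univ
  constructor
  · intro h; exact ⟨h _, h _, h _, h _, h _, h _, h _⟩
  · rintro ⟨h1, h2, h3, h4, h5, h6, h7⟩ i
    have := h i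
    simp only [Finset.mem_insert, Finset.mem_singleton] at this
    rcases this with rfl | rfl | rfl | rfl | rfl | rfl | rfl <;> assumption

/-- Balance of outflow and inflow at each state. Sampling a correct estimate is a diagonal rate and
drops out. -/
lemma isStationaryDistr_monGen_iff {α β γ lam μ : ℝ} (π : MonState → ℝ) :
    IsStationaryDistr (monGen α β γ lam μ) π ↔ (∀ i, 0 ≤ π i) ∧
      (π s00 + π s10 + π s01 + π s11 + π s02 + π s12 + π s22 = 1) ∧
      (α + lam) * π s00 = β * π s10 + μ * π s01 + μ * π s02 ∧
      (β + μ + lam) * π s10 = α * π s00 ∧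
      (α + μ) * π s01 = β * π s11 ∧
      β * π s11 = (μ + lam) * π s10 + α * π s01 + μ * π s12 ∧
      (α + μ) * π s02 = β * π s12 + γ * π s22 ∧
      (β + μ) * π s12 = α * π s02 ∧
      γ * π s22 = lam * π s00 := by
  rw [IsStationaryDistr, sum_monState, funext_iff, forall_monState (p := fun i => _ = _)]
  refine and_congr_right fun _ => and_congr_right fun _ => ?_
  simp only [monGen, vecMul_generatorOf, sum_monState, Pi.zero_apply]
  simp [monRate, s00, s10, s01, s11, s02, s12, s22]
  constructor
  · rintro ⟨h1, h2, h3, h4, h5, h6, h7⟩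
    refine ⟨?_, ?_, ?_, ?_, ?_, ?_, ?_⟩ <;> linarith
  · rintro ⟨h1, h2, h3, h4, h5, h6, h7⟩
    refine ⟨?_, ?_, ?_, ?_, ?_, ?_, ?_⟩ <;> linarith

/-- The stationary distribution for `μ > 0`, up to normalization. -/
noncomputable def monWeight (α β γ lam μ : ℝ) (i : MonState) : ℝ :=
  match i.1 with
  | (0, 0) => μ
  | (1, 0) => α * μ / (β + μ + lam)
  | (0, 1) => (μ + lam) * α / (β + μ + lam) + α * lam / (α + β + μ)
  | (1, 1) => (α + μ) / β * ((μ + lam) * α / (β + μ + lam) + α * lam / (α + β + μ))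
  | (0, 2) => lam * (β + μ) / (α + β + μ)
  | (1, 2) => α * lam / (α + β + μ)
  | _ => lam * μ / γ

section monWeight

variable (α β γ lam μ : ℝ)

lemma monWeight_s00 : monWeight α β γ lam μ s00 = μ := rfl
lemma monWeight_s10 : monWeight α β γ lam μ s10 = α * μ / (β + μ + lam) := rfl
lemma monWeight_s01 : monWeight α β γ lam μ s01 =
    (μ + lam) * α / (β + μ + lam) + α * lam / (α + β + μ) := rfl
lemma monWeight_s11 : monWeight α β γ lam μ s11 =
    (α + μ) / β * ((μ + lam) * α / (β + μ + lam) + α * lam / (α + β + μ)) := rfl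
lemma monWeight_s02 : monWeight α β γ lam μ s02 = lam * (β + μ) / (α + β + μ) := rfl
lemma monWeight_s12 : monWeight α β γ lam μ s12 = α * lam / (α + β + μ) := rfl
lemma monWeight_s22 : monWeight α β γ lam μ s22 = lam * μ / γ := rfl

end monWeight

section stationary

variable {α β γ lam μ : ℝ}

lemma monWeight_pos (hα : 0 < α) (hβ : 0 < β) (hγ : 0 < γ) (hlam : 0 < lam) (hμ : 0 < μ)
    (i : MonState) : 0 < monWeight α β γ lam μ i := by
  revert i
  rw [forall_monState]
  simp only [monWeight_s00, monWeight_s10, monWeight_s01, monWeight_s11, monWeight_s02,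
    monWeight_s12, monWeight_s22]
  refine ⟨?_, ?_, ?_, ?_, ?_, ?_, ?_⟩ <;> positivity

lemma sum_monWeight_pos (hα : 0 < α) (hβ : 0 < β) (hγ : 0 < γ) (hlam : 0 < lam) (hμ : 0 < μ) :
    0 < ∑ i, monWeight α β γ lam μ i :=
  Finset.sum_pos (fun i _ => monWeight_pos hα hβ hγ hlam hμ i) ⟨s00, Finset.mem_univ _⟩

lemma isStationaryDistr_monWeight (hα : 0 < α) (hβ : 0 < β) (hγ : 0 < γ) (hlam : 0 < lam)
    (hμ : 0 < μ) : IsStationaryDistr (monGen α β γ lam μ)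
      (fun i => monWeight α β γ lam μ i / ∑ j, monWeight α β γ lam μ j) := by
  have hW := sum_monWeight_pos hα hβ hγ hlam hμ
  rw [isStationaryDistr_monGen_iff]
  refine ⟨fun i => div_nonneg (monWeight_pos hα hβ hγ hlam hμ i).le hW.le, ?_, ?_⟩
  · rw [← sum_monState (fun i => monWeight α β γ lam μ i / ∑ j, monWeight α β γ lam μ j),
      ← Finset.sum_div, div_self hW.ne']
  generalize ∑ j, monWeight α β γ lam μ j = W at hW
  simp only [monWeight_s00, monWeight_s10, monWeight_s01, monWeight_s11, monWeight_s02,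
    monWeight_s12, monWeight_s22]
  have h1 : β + μ + lam ≠ 0 := by positivity
  have h2 : α + β + μ ≠ 0 := by positivity
  refine ⟨?_, ?_, ?_, ?_, ?_, ?_, ?_⟩ <;> field_simp <;> ring

lemma IsStationaryDistr.eq_monWeight (hα : 0 < α) (hβ : 0 < β) (hγ : 0 < γ) (hlam : 0 < lam)
    (hμ : 0 < μ) {π : MonState → ℝ} (hπ : IsStationaryDistr (monGen α β γ lam μ) π) (i : MonState) :
    π i = monWeight α β γ lam μ i / ∑ j, monWeight α β γ lam μ j := by
  have hsum := hπ.2.1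
  rw [isStationaryDistr_monGen_iff] at hπ
  obtain ⟨-, -, e1, e2, e3, e4, e5, e6, e7⟩ := hπ
  have h1 : β + μ + lam ≠ 0 := by positivity
  have h2 : α + β + μ ≠ 0 := by positivity
  have h3 : β + μ ≠ 0 := by positivity
  have hb : π s10 = α * π s00 / (β + μ + lam) := by rw [eq_div_iff h1]; linarith
  have he : π s02 = π s00 / μ * (lam * (β + μ) / (α + β + μ)) := by
    have : μ * (α + β + μ) * π s02 = lam * (β + μ) * π s00 := by
      -- Eliminates `π s12` and `π s22` from the balance equations of (0,2), (1,2) and (2,2).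
      linear_combination (β + μ) * e5 + β * e6 + (β + μ) * e7
    field_simp
    linear_combination this
  have hf : π s12 = π s00 / μ * (α * lam / (α + β + μ)) := by
    have : (β + μ) * π s12 = (β + μ) * (π s00 / μ * (α * lam / (α + β + μ))) := by
      rw [e6, he]; field_simp
    exact mul_left_cancel₀ h3 this
  have hc : π s01 = π s00 / μ * ((μ + lam) * α / (β + μ + lam) + α * lam / (α + β + μ)) := by
    -- Flow balance across the set where the estimate is 1: adding the equations of its two states
    -- cancels the internal flows.
    have : μ * π s01 = (μ + lam) * π s10 + μ * π s12 := by linear_combination e3 + e4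
    rw [hb, hf] at this
    apply mul_left_cancel₀ hμ.ne'
    rw [this]
    field_simp
  -- Every solution is a multiple of `monWeight`, and the total mass fixes the factor. Dividing by
  -- `μ` is essential: without sampling there are two closed classes.
  have key : ∀ i, π i = π s00 / μ * monWeight α β γ lam μ i := by
    rw [forall_monState]
    simp only [monWeight_s00, monWeight_s10, monWeight_s01, monWeight_s11, monWeight_s02,
      monWeight_s12, monWeight_s22]
    refine ⟨?_, ?_, hc, ?_, he, hf, ?_⟩
    · field_simp
    · rw [hb]; field_simp
    · apply mul_left_cancel₀ hβ.ne'
      rw [← e3, hc]; field_simp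
    · apply mul_left_cancel₀ hγ.ne'
      rw [e7]; field_simp
  have hW := sum_monWeight_pos hα hβ hγ hlam hμ
  rw [Finset.sum_congr rfl fun i _ => key i, ← Finset.mul_sum] at hsum
  rw [key i, eq_div_iff hW.ne', mul_right_comm, hsum, one_mul]

lemma existsUnique_isStationaryDistr_monGen (hα : 0 < α) (hβ : 0 < β) (hγ : 0 < γ) (hlam : 0 < lam)
    (hμ : 0 < μ) : ∃! π : MonState → ℝ, IsStationaryDistr (monGen α β γ lam μ) π :=
  ⟨_, isStationaryDistr_monWeight hα hβ hγ hlam hμ,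
    fun _ h => funext (h.eq_monWeight hα hβ hγ hlam hμ)⟩

lemma continuousAt_monWeight (hα : 0 < α) (hβ : 0 < β) (hlam : 0 < lam) (i : MonState) :
    ContinuousAt (fun μ => monWeight α β γ lam μ i) 0 := by
  have h1 : β + 0 + lam ≠ 0 := by positivity
  have h2 : α + β + 0 ≠ 0 := by positivity
  revert i
  rw [forall_monState]
  simp only [monWeight_s00, monWeight_s10, monWeight_s01, monWeight_s11, monWeight_s02,
    monWeight_s12, monWeight_s22]
  refine ⟨?_, ?_, ?_, ?_, ?_, ?_, ?_⟩ <;> fun_prop (disch := assumption)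

lemma tendsto_stationary_freshness (hα : 0 < α) (hβ : 0 < β) (hγ : 0 < γ) (hlam : 0 < lam)
    {π : ℝ → MonState → ℝ} (hπ : ∀ μ, 0 < μ → IsStationaryDistr (monGen α β γ lam μ) (π μ)) :
    Tendsto (fun μ => 1 - (π μ s10 + π μ s01 + π μ s02)) (𝓝[>] 0) (𝓝 (α / (α + β))) := by
  have hw := fun i => continuousAt_monWeight (γ := γ) hα hβ hlam i
  -- At `μ = 0` only the closed classes carry weight, and each busy state weighs α/β times its free
  -- partner; hence the factor 1 + α/β.
  have hsum : ∑ j, monWeight α β γ lam 0 j = (α + β) / β *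
      (monWeight α β γ lam 0 s10 + monWeight α β γ lam 0 s01 + monWeight α β γ lam 0 s02) := by
    rw [sum_monState]
    simp only [monWeight_s00, monWeight_s10, monWeight_s01, monWeight_s11, monWeight_s02,
      monWeight_s12, monWeight_s22, add_zero, zero_add, mul_zero, zero_div]
    field_simp
    ring
  have hpos : 0 < monWeight α β γ lam 0 s10 + monWeight α β γ lam 0 s01 +
      monWeight α β γ lam 0 s02 := by
    simp only [monWeight_s10, monWeight_s01, monWeight_s02, add_zero, zero_add, mul_zero, zero_div]
    positivity
  have hne : ∑ j, monWeight α β γ lam 0 j ≠ 0 := by rw [hsum]; positivity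
  have hcont : ContinuousAt (fun μ => 1 - (monWeight α β γ lam μ s10 + monWeight α β γ lam μ s01 +
      monWeight α β γ lam μ s02) / ∑ j, monWeight α β γ lam μ j) 0 := by
    fun_prop (disch := assumption)
  have hlim := hcont.tendsto
  have hval : 1 - (monWeight α β γ lam 0 s10 + monWeight α β γ lam 0 s01 +
      monWeight α β γ lam 0 s02) / ∑ j, monWeight α β γ lam 0 j = α / (α + β) := by
    rw [hsum]
    generalize monWeight α β γ lam 0 s10 + monWeight α β γ lam 0 s01 +
      monWeight α β γ lam 0 s02 = x at hpos
    field_simp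
    ring
  rw [hval] at hlim
  refine (hlim.mono_left nhdsWithin_le_nhds).congr' ?_
  filter_upwards [self_mem_nhdsWithin] with μ hμ
  simp only [(hπ μ hμ).eq_monWeight hα hβ hγ hlam hμ, add_div]

end stationary

/-! ### Exponential clocks -/

lemma expMeasure_one_eq :
    expMeasure 1 = (volume.restrict (Set.Ici 0)).withDensity
      (fun x => ENNReal.ofReal (Real.exp (-x))) := by
  rw [expMeasure, gammaMeasure, ← withDensity_indicator measurableSet_Ici]
  congr 1
  ext x
  by_cases hx : 0 ≤ x
  · simp [Set.indicator, hx, gammaPDF_of_nonneg]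
  · simp [Set.indicator, hx, gammaPDF_of_neg (not_le.1 hx)]

lemma expMeasure_one_Iic_zero : expMeasure 1 (Set.Iic 0) = 0 := by
  rw [expMeasure, gammaMeasure, withDensity_apply _ measurableSet_Iic,
    setLIntegral_congr Iio_ae_eq_Iic.symm, lintegral_gammaPDF_of_nonpos le_rfl]

/-- The integrand against Lebesgue measure is that of the Gamma integral at 2. -/
lemma integrable_id_expMeasure_one : Integrable (fun x : ℝ => x) (expMeasure 1) := by
  have h := Real.GammaIntegral_convergent (s := 2) two_pos
  rw [expMeasure_one_eq, integrable_withDensity_iff (by fun_prop) (by simp),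
    ← IntegrableOn, integrableOn_Ici_iff_integrableOn_Ioi]
  refine h.congr_fun (fun x _ => ?_) measurableSet_Ioi
  norm_num [ENNReal.toReal_ofReal (Real.exp_pos _).le, mul_comm]

lemma integral_id_expMeasure_one : ∫ x, x ∂(expMeasure 1) = 1 := by
  have h := Real.Gamma_eq_integral (s := 2) two_pos
  rw [expMeasure_one_eq, integral_withDensity_eq_integral_toReal_smul (by fun_prop) (by simp),
    integral_Ici_eq_integral_Ioi, ← Real.Gamma_two, h]
  refine setIntegral_congr_fun measurableSet_Ioi (fun x _ => ?_)
  norm_num [ENNReal.toReal_ofReal (Real.exp_pos _).le]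

section clocks

variable {Ω : Type*} [MeasurableSpace Ω] {P : Measure Ω} {E : ℕ → Ω → ℝ}

lemma ae_clock_pos (hm : ∀ n, Measurable (E n)) (hlaw : ∀ n, P.map (E n) = expMeasure 1) :
    ∀ᵐ ω ∂P, ∀ n, 0 < E n ω := by
  rw [ae_all_iff]
  intro n
  have h := expMeasure_one_Iic_zero
  rw [← hlaw n, Measure.map_apply (hm n) measurableSet_Iic] at h
  rw [ae_iff]
  simpa [Set.preimage] using h

/-- Strong law along a deterministic subsequence of clocks; it is needed for the even and the odd
indices. -/
lemma ae_tendsto_clock_average (hm : ∀ n, Measurable (E n))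
    (hlaw : ∀ n, P.map (E n) = expMeasure 1) (hind : iIndepFun E P) {g : ℕ → ℕ}
    (hg : Function.Injective g) :
    ∀ᵐ ω ∂P, Tendsto (fun n : ℕ => (∑ i ∈ Finset.range n, E (g i) ω) / n) atTop (𝓝 1) := by
  have hint : Integrable (E (g 0)) P := by
    have := integrable_id_expMeasure_one
    rw [← hlaw (g 0), integrable_map_measure (by fun_prop) (hm _).aemeasurable] at this
    exact this
  have hmean : ∫ ω, E (g 0) ω ∂P = 1 := by
    have := integral_id_expMeasure_one
    rw [← hlaw (g 0), integral_map (hm _).aemeasurable (by fun_prop)] at this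
    exact this
  rw [← hmean]
  exact strong_law_ae_real (fun i => E (g i)) hint
    (fun i j hij => hind.indepFun (hg.ne hij))
    (fun i => ⟨(hm _).aemeasurable, (hm _).aemeasurable, by rw [hlaw, hlaw]⟩)

end clocks

/-! ### Alternating averages -/

lemma sum_range_alternating (e : ℕ → ℝ) (a b : ℝ) (n : ℕ) :
    ∑ k ∈ Finset.range n, (if Even k then a else b) * e k =
      a * ∑ i ∈ Finset.range ((n + 1) / 2), e (2 * i) +
        b * ∑ i ∈ Finset.range (n / 2), e (2 * i + 1) := by
  induction n with
  | zero => simp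
  | succ n ih =>
    rw [Finset.sum_range_succ, ih]
    rcases Nat.even_or_odd' n with ⟨m, rfl | rfl⟩
    · rw [show (2 * m + 1 + 1) / 2 = m + 1 by omega, show (2 * m + 1) / 2 = m by omega,
        show 2 * m / 2 = m by omega, Finset.sum_range_succ _ m]
      simp
      ring
    · rw [show (2 * m + 1 + 1 + 1) / 2 = m + 1 by omega, show (2 * m + 1 + 1) / 2 = m + 1 by omega,
        show (2 * m + 1) / 2 = m by omega, Finset.sum_range_succ _ m,
        Finset.sum_range_succ _ m]
      simp
      ring

lemma tendsto_natCast_half_div : Tendsto (fun n : ℕ => ((n / 2 : ℕ) : ℝ) / n) atTop (𝓝 (1 / 2)) := by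
  have h : Tendsto (fun n : ℕ => (⌊(1 / 2 : ℝ) * n⌋₊ : ℝ) / n) atTop (𝓝 (1 / 2)) :=
    (tendsto_nat_floor_mul_div_atTop (R := ℝ) (a := 1 / 2) (by norm_num)).comp
      tendsto_natCast_atTop_atTop
  refine h.congr fun n => ?_
  rw [show (1 / 2 : ℝ) * n = (n : ℝ) / (2 : ℕ) by push_cast; ring, Nat.floor_div_natCast,
    Nat.floor_natCast]

lemma tendsto_alternating_average {e : ℕ → ℝ}
    (he : Tendsto (fun n : ℕ => (∑ i ∈ Finset.range n, e (2 * i)) / n) atTop (𝓝 1))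
    (ho : Tendsto (fun n : ℕ => (∑ i ∈ Finset.range n, e (2 * i + 1)) / n) atTop (𝓝 1))
    (a b : ℝ) :
    Tendsto (fun n : ℕ => (∑ k ∈ Finset.range n, (if Even k then a else b) * e k) / n) atTop
      (𝓝 ((a + b) / 2)) := by
  have hhalf : Tendsto (fun n : ℕ => n / 2) atTop atTop :=
    Nat.tendsto_div_const_atTop two_ne_zero
  have hhalf' : Tendsto (fun n : ℕ => (n + 1) / 2) atTop atTop :=
    hhalf.comp (tendsto_add_atTop_nat 1)
  have hr : Tendsto (fun n : ℕ => (((n + 1) / 2 : ℕ) : ℝ) / n) atTop (𝓝 (1 / 2)) := by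
    have h1 := (tendsto_natCast_half_div.comp (tendsto_add_atTop_nat 1)).mul
      ((tendsto_const_nhds (x := (1 : ℝ))).add tendsto_one_div_atTop_nhds_zero_nat)
    rw [add_zero, mul_one] at h1
    refine h1.congr' ?_
    filter_upwards [eventually_gt_atTop 0] with n hn
    simp only [Function.comp_apply]
    push_cast
    field_simp
  have h := (((he.comp hhalf').mul hr).const_mul a).add
    (((ho.comp hhalf).mul tendsto_natCast_half_div).const_mul b)
  rw [show a * (1 * (1 / 2)) + b * (1 * (1 / 2)) = (a + b) / 2 by ring] at h
  refine h.congr' ?_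
  -- From 2 on both half-counts are nonzero, so they cancel in the products of ratios.
  filter_upwards [eventually_ge_atTop 2] with n hn
  have h1 : (((n + 1) / 2 : ℕ) : ℝ) ≠ 0 := by
    rw [Nat.cast_ne_zero]; omega
  have h2 : ((n / 2 : ℕ) : ℝ) ≠ 0 := by
    rw [Nat.cast_ne_zero]; omega
  simp only [Function.comp_apply]
  rw [sum_range_alternating, div_mul_div_cancel₀ h1, div_mul_div_cancel₀ h2]
  ring

/-- The entry time `N` varies with the path, but only its parity matters: it decides which of `a`
and `b` goes with the even clocks, and the limit is symmetric in them. The law of large numbers is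
thus needed only for fixed subsequences. The first `N` terms are lost in the average. -/
lemma tendsto_average_of_eventually_alternating {e w : ℕ → ℝ}
    (he : Tendsto (fun n : ℕ => (∑ i ∈ Finset.range n, e (2 * i)) / n) atTop (𝓝 1))
    (ho : Tendsto (fun n : ℕ => (∑ i ∈ Finset.range n, e (2 * i + 1)) / n) atTop (𝓝 1))
    {a b : ℝ} {N : ℕ} (hw : ∀ k, w (N + k) = if Even k then a else b) :
    Tendsto (fun n : ℕ => (∑ k ∈ Finset.range n, w k * e k) / n) atTop (𝓝 ((a + b) / 2)) := by
  obtain ⟨a', b', hab, hw'⟩ : ∃ a' b' : ℝ, a' + b' = a + b ∧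
      ∀ k, N ≤ k → w k = if Even k then a' else b' := by
    by_cases hN : Even N
    · refine ⟨a, b, rfl, fun k hk => ?_⟩
      obtain ⟨m, rfl⟩ := Nat.exists_eq_add_of_le hk
      simp [hw, Nat.even_add, hN]
    · refine ⟨b, a, add_comm _ _, fun k hk => ?_⟩
      obtain ⟨m, rfl⟩ := Nat.exists_eq_add_of_le hk
      by_cases hm : Even m <;> simp [hw, Nat.even_add, hN, hm]
  rw [← hab]
  have h := (tendsto_alternating_average he ho a' b').add
    (tendsto_const_div_atTop_nhds_zero_nat
      (∑ k ∈ Finset.range N, (w k * e k - (if Even k then a' else b') * e k)))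
  rw [add_zero] at h
  refine h.congr' ?_
  filter_upwards [eventually_ge_atTop N] with n hn
  rw [← add_div]
  congr 1
  rw [← eq_sub_iff_add_eq', ← Finset.sum_sub_distrib]
  refine Finset.sum_subset (Finset.range_mono hn) fun k _ hk => ?_
  rw [hw' k (by simpa using hk), sub_self]

/-! ### Time averages of step functions -/

section stepFunction

variable {J c : ℕ → ℝ} {f : ℝ → ℝ}

lemma exists_mem_step (hJ0 : J 0 = 0) (hJ : Tendsto J atTop atTop) {t : ℝ} (ht : 0 ≤ t) :
    ∃ n, J n ≤ t ∧ t < J (n + 1) := by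
  classical
  have hex : ∃ n, t < J n := (hJ.eventually_gt_atTop t).exists
  have hpos : Nat.find hex ≠ 0 := fun h => by
    have := Nat.find_spec hex
    rw [h, hJ0] at this
    linarith
  obtain ⟨n, hn⟩ := Nat.exists_eq_succ_of_ne_zero hpos
  exact ⟨n, not_lt.1 (Nat.find_min hex (by omega)), by have := Nat.find_spec hex; rwa [hn] at this⟩

lemma integrable_and_integral_step (hJ0 : J 0 = 0) (hmono : Monotone J)
    (hf : ∀ n t, J n ≤ t → t < J (n + 1) → f t = c n) (n : ℕ) :
    IntervalIntegrable f volume 0 (J n) ∧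
      ∫ t in (0 : ℝ)..J n, f t = ∑ k ∈ Finset.range n, c k * (J (k + 1) - J k) := by
  induction n with
  | zero => simp [hJ0]
  | succ n ih =>
    have hle : J n ≤ J (n + 1) := hmono n.le_succ
    have hae : ∀ᵐ t ∂(volume.restrict (Set.uIoc (J n) (J (n + 1)))), c n = f t := by
      -- The value of `f` is known on the half-open interval closed on the left, the integral uses
      -- the one closed on the right; they differ by a null set.
      rw [Set.uIoc_of_le hle, ← restrict_Ico_eq_restrict_Ioc]
      exact (ae_restrict_mem measurableSet_Ico).mono fun t ht => (hf n t ht.1 ht.2).symm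
    have hint : IntervalIntegrable f volume (J n) (J (n + 1)) :=
      (intervalIntegrable_const (c := c n)).congr_ae hae
    refine ⟨ih.1.trans hint, ?_⟩
    rw [← intervalIntegral.integral_add_adjacent_intervals ih.1 hint, ih.2, Finset.sum_range_succ,
      ← intervalIntegral.integral_congr_ae_restrict hae, intervalIntegral.integral_const,
      smul_eq_mul, mul_comm (c n)]

/-- With `A n` the integral up to `J n`, monotonicity puts the average over [0, T] between `A n / J
(n + 1)` and `A (n + 1) / J n` when T lies in the `n`-th step. Both bounds tend to `p / q`. Since `q
> 0`, the jump times are unbounded, so there is no explosion. -/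
lemma tendsto_time_average_step (hJ0 : J 0 = 0) (hmono : Monotone J)
    (hf : ∀ n t, J n ≤ t → t < J (n + 1) → f t = c n) (hc : ∀ n, 0 ≤ c n) {p q : ℝ} (hq : 0 < q)
    (hJ : Tendsto (fun n : ℕ => J n / n) atTop (𝓝 q))
    (hA : Tendsto (fun n : ℕ => (∑ k ∈ Finset.range n, c k * (J (k + 1) - J k)) / n) atTop (𝓝 p)) :
    Tendsto (fun T : ℝ => (1 / T) * ∫ t in (0 : ℝ)..T, f t) atTop (𝓝 (p / q)) := by
  set A : ℕ → ℝ := fun n => ∑ k ∈ Finset.range n, c k * (J (k + 1) - J k) with hAdef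
  have hJtop : Tendsto J atTop atTop := by
    refine (hJ.pos_mul_atTop hq tendsto_natCast_atTop_atTop).congr' ?_
    filter_upwards [eventually_gt_atTop 0] with n hn
    field_simp
  have hex : ∀ T : ℝ, ∃ n, 0 ≤ T → J n ≤ T ∧ T < J (n + 1) := by
    intro T
    by_cases hT : 0 ≤ T
    · obtain ⟨n, hn⟩ := exists_mem_step hJ0 hJtop hT
      exact ⟨n, fun _ => hn⟩
    · exact ⟨0, fun h => absurd h hT⟩
  choose ν hν using hex
  have hνtop : Tendsto ν atTop atTop := by
    rw [tendsto_atTop]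
    intro m
    filter_upwards [eventually_ge_atTop (J m), eventually_ge_atTop 0] with T hT hT0
    by_contra! hlt
    have := hmono (show ν T + 1 ≤ m from hlt)
    linarith [(hν T hT0).2]
  have hr : Tendsto (fun n : ℕ => ((n : ℝ) + 1) / n) atTop (𝓝 1) := by
    have h := (tendsto_const_nhds (x := (1 : ℝ))).add tendsto_one_div_atTop_nhds_zero_nat
    rw [add_zero] at h
    refine h.congr' ?_
    filter_upwards [eventually_gt_atTop 0] with n hn
    field_simp
  have hJ1 : Tendsto (fun n : ℕ => J (n + 1) / n) atTop (𝓝 q) := by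
    have h := (hJ.comp (tendsto_add_atTop_nat 1)).mul hr
    rw [mul_one] at h
    refine h.congr fun n => ?_
    simp only [Function.comp_apply]
    push_cast
    exact div_mul_div_cancel₀ n.cast_add_one_ne_zero
  have hA1 : Tendsto (fun n : ℕ => A (n + 1) / n) atTop (𝓝 p) := by
    have h := (hA.comp (tendsto_add_atTop_nat 1)).mul hr
    rw [mul_one] at h
    refine h.congr fun n => ?_
    simp only [Function.comp_apply]
    push_cast
    exact div_mul_div_cancel₀ n.cast_add_one_ne_zero
  have hlow : Tendsto (fun n : ℕ => A n / J (n + 1)) atTop (𝓝 (p / q)) := by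
    refine (hA.div hJ1 hq.ne').congr' ?_
    filter_upwards [eventually_gt_atTop 0] with n hn
    exact div_div_div_cancel_right₀ (Nat.cast_ne_zero.2 hn.ne') _ _
  have hup : Tendsto (fun n : ℕ => A (n + 1) / J n) atTop (𝓝 (p / q)) := by
    refine (hA1.div hJ hq.ne').congr' ?_
    filter_upwards [eventually_gt_atTop 0] with n hn
    exact div_div_div_cancel_right₀ (Nat.cast_ne_zero.2 hn.ne') _ _
  have hfnn : ∀ t, 0 ≤ t → 0 ≤ f t := by
    intro t ht
    rw [hf (ν t) t (hν t ht).1 (hν t ht).2]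
    exact hc _
  have hFmono : ∀ n T, 0 ≤ T → T ≤ J n → IntervalIntegrable f volume 0 T := by
    intro n T h0 hT
    refine (integrable_and_integral_step hJ0 hmono hf n).1.mono_set ?_
    rw [Set.uIcc_of_le h0, Set.uIcc_of_le (h0.trans hT)]
    exact Set.Icc_subset_Icc_right hT
  have hFle : ∀ n S T, 0 ≤ S → S ≤ T → T ≤ J n →
      ∫ t in (0 : ℝ)..S, f t ≤ ∫ t in (0 : ℝ)..T, f t := by
    intro n S T h0 hST hT
    refine intervalIntegral.integral_mono_interval le_rfl h0 hST ?_ (hFmono n T (h0.trans hST) hT)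
    exact (ae_restrict_mem measurableSet_Ioc).mono fun t ht => hfnn t ht.1.le
  have hJnn : ∀ n, 0 ≤ J n := fun n => hJ0 ▸ hmono n.zero_le
  refine tendsto_of_tendsto_of_tendsto_of_le_of_le' (hlow.comp hνtop) (hup.comp hνtop) ?_ ?_
  · filter_upwards [eventually_gt_atTop 0] with T hT
    obtain ⟨h1, h2⟩ := hν T hT.le
    have hF := hFle (ν T + 1) (J (ν T)) T (hJnn _) h1 h2.le
    rw [(integrable_and_integral_step hJ0 hmono hf _).2] at hF
    have hAnn : 0 ≤ A (ν T) := Finset.sum_nonneg fun k _ =>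
      mul_nonneg (hc k) (sub_nonneg.2 (hmono k.le_succ))
    rw [Function.comp_apply, one_div_mul_eq_div]
    exact div_le_div₀ (hAnn.trans hF) hF hT h2.le
  · filter_upwards [eventually_gt_atTop 0,
      (hJtop.comp hνtop).eventually_gt_atTop 0] with T hT hJT
    obtain ⟨h1, h2⟩ := hν T hT.le
    have hF := hFle (ν T + 1) T (J (ν T + 1)) hT.le h2.le le_rfl
    rw [(integrable_and_integral_step hJ0 hmono hf _).2] at hF
    have hAnn : 0 ≤ A (ν T + 1) := Finset.sum_nonneg fun k _ =>
      mul_nonneg (hc k) (sub_nonneg.2 (hmono k.le_succ))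
    rw [Function.comp_apply, one_div_mul_eq_div]
    exact div_le_div₀ hAnn hF hJT h1

end stepFunction

/-! ### Paths of jump-and-hold processes -/

section jumpHold

variable {Ω S : Type*} {Q : Matrix S S ℝ} {Z : ℕ → Ω → S}
  {E : ℕ → Ω → ℝ} {Y : ℝ → Ω → S}

lemma jumpTime_zero (ω : Ω) : jumpTime Q Z E 0 ω = 0 := by simp [jumpTime]

lemma jumpTime_succ (n : ℕ) (ω : Ω) :
    jumpTime Q Z E (n + 1) ω = jumpTime Q Z E n ω + E n ω / exitRate Q (Z n ω) :=
  Finset.sum_range_succ _ _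

lemma strictMono_jumpTime (hQ : ∀ i, 0 < exitRate Q i) {ω : Ω} (hE : ∀ n, 0 < E n ω) :
    StrictMono fun n => jumpTime Q Z E n ω :=
  strictMono_nat_of_lt_succ fun n => by
    rw [jumpTime_succ]
    exact lt_add_of_pos_right _ (div_pos (hE n) (hQ _))

lemma eq_of_mem_holding (hQ : ∀ i, 0 < exitRate Q i) {ω : Ω}
    (hpath : ∀ (n : ℕ) (t : ℝ), jumpTime Q Z E n ω ≤ t →
      (t - jumpTime Q Z E n ω) * exitRate Q (Z n ω) < E n ω → Y t ω = Z n ω)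
    {n : ℕ} {t : ℝ} (h1 : jumpTime Q Z E n ω ≤ t) (h2 : t < jumpTime Q Z E (n + 1) ω) :
    Y t ω = Z n ω := by
  refine hpath n t h1 ?_
  rw [jumpTime_succ] at h2
  rw [← lt_div_iff₀ (hQ _)]
  linarith

/-- The first `n` jumps stay in `D`, the `(n + 1)`-st leaves `D`. -/
lemma mem_exitsFrom_of_chain (hQ : ∀ i, 0 < exitRate Q i) {ω : Ω} (hE : ∀ n, 0 < E n ω)
    (hpath : ∀ (n : ℕ) (t : ℝ), jumpTime Q Z E n ω ≤ t →
      (t - jumpTime Q Z E n ω) * exitRate Q (Z n ω) < E n ω → Y t ω = Z n ω)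
    {D : Set S} {n : ℕ} (hD : ∀ k ≤ n, Z k ω ∈ D) (hexit : Z (n + 1) ω ∉ D) :
    ω ∈ exitsFrom D Y (Z n ω) := by
  have hmono := strictMono_jumpTime (Z := Z) hQ hE
  have h0 := jumpTime_zero (Q := Q) (Z := Z) (E := E) ω
  refine ⟨jumpTime Q Z E (n + 1) ω, ?_, ?_, ?_, ?_⟩
  · rw [← h0]
    exact hmono n.succ_pos
  · intro t ht0 ht
    have hstep : ∀ m ≤ n + 1, t < jumpTime Q Z E m ω → Y t ω ∈ D := by
      intro m
      induction m with
      | zero => intro _ h; linarith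
      | succ m ih =>
        intro hm h
        by_cases hlt : t < jumpTime Q Z E m ω
        · exact ih (by omega) hlt
        · rw [eq_of_mem_holding hQ hpath (not_lt.1 hlt) h]
          exact hD m (by omega)
    exact hstep _ le_rfl ht
  · rw [eq_of_mem_holding hQ hpath le_rfl (hmono (n + 1).lt_succ_self)]
    exact hexit
  · filter_upwards [Ico_mem_nhdsLT (hmono n.lt_succ_self)] with t ht
    exact eq_of_mem_holding hQ hpath ht.1 ht.2

/-- Renewal-reward: mean reward of a cycle over its mean length, the mean holding time at a state
being the inverse of its exit rate. -/
lemma freshness_eq_of_alternating (hQ : ∀ i, 0 < exitRate Q i) {ω : Ω} (hE : ∀ n, 0 < E n ω)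
    (hpath : ∀ (n : ℕ) (t : ℝ), jumpTime Q Z E n ω ≤ t →
      (t - jumpTime Q Z E n ω) * exitRate Q (Z n ω) < E n ω → Y t ω = Z n ω)
    (he : Tendsto (fun n : ℕ => (∑ i ∈ Finset.range n, E (2 * i) ω) / n) atTop (𝓝 1))
    (ho : Tendsto (fun n : ℕ => (∑ i ∈ Finset.range n, E (2 * i + 1) ω) / n) atTop (𝓝 1))
    {C : S → ℝ} (hC : ∀ i, 0 ≤ C i) {a b : S} {N : ℕ}
    (hZ : ∀ k, Z (N + k) ω = if Even k then a else b) :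
    freshness C Y ω = (C a / exitRate Q a + C b / exitRate Q b) /
      (1 / exitRate Q a + 1 / exitRate Q b) := by
  have hdiff : ∀ k, jumpTime Q Z E (k + 1) ω - jumpTime Q Z E k ω =
      E k ω / exitRate Q (Z k ω) := fun k => by rw [jumpTime_succ, add_sub_cancel_left]
  have hJ := tendsto_average_of_eventually_alternating (e := fun k => E k ω) he ho
    (w := fun k => 1 / exitRate Q (Z k ω)) (a := 1 / exitRate Q a) (b := 1 / exitRate Q b) (N := N)
    (fun k => by rw [hZ]; split_ifs <;> rfl)
  have hA := tendsto_average_of_eventually_alternating (e := fun k => E k ω) he ho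
    (w := fun k => C (Z k ω) / exitRate Q (Z k ω)) (a := C a / exitRate Q a)
    (b := C b / exitRate Q b) (N := N) (fun k => by rw [hZ]; split_ifs <;> rfl)
  have hq : 0 < (1 / exitRate Q a + 1 / exitRate Q b) / 2 := by
    have := hQ a
    have := hQ b
    positivity
  have key := tendsto_time_average_step (J := fun n => jumpTime Q Z E n ω)
    (c := fun n => C (Z n ω)) (f := fun t => C (Y t ω)) (jumpTime_zero ω)
    (strictMono_jumpTime hQ hE).monotone
    (fun n t h1 h2 => by rw [eq_of_mem_holding hQ hpath h1 h2]) (fun n => hC _) hq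
    (hJ.congr fun n => by
      refine congrArg (· / (n : ℝ)) (Finset.sum_congr rfl fun k _ => ?_)
      rw [one_div_mul_eq_div])
    (hA.congr fun n => by
      refine congrArg (· / (n : ℝ)) (Finset.sum_congr rfl fun k _ => ?_)
      rw [hdiff, div_mul_eq_mul_div, mul_div_assoc])
  rw [freshness, key.limsup_eq, div_div_div_cancel_right₀ two_ne_zero]

variable [Fintype S] [DecidableEq S] [MeasurableSpace Ω] [MeasurableSpace S] {P : Measure Ω} {x₀ : S}

/-- There are countably many finite paths, so almost surely none of probability zero occurs. -/
lemma IsJumpHold.ae_chain [IsFiniteMeasure P] (h : IsJumpHold P Q x₀ Z E Y) :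
    ∀ᵐ ω ∂P, Z 0 ω = x₀ ∧ ∀ n, embeddedMatrix Q (Z n ω) (Z (n + 1) ω) ≠ 0 := by
  -- Freezes a finite path at its last state: `chain_law` takes infinite sequences, but the union of
  -- null sets must be countable.
  let ext (n : ℕ) (v : Fin (n + 1) → S) (k : ℕ) : S := v ⟨min k n, by omega⟩
  have hcyl : ∀ᵐ ω ∂P, ∀ (n : ℕ) (v : Fin (n + 1) → S), (∀ k ≤ n, Z k ω = ext n v k) →
      (if ext n v 0 = x₀ then (1 : ℝ) else 0) *
        ∏ k ∈ Finset.range n, embeddedMatrix Q (ext n v k) (ext n v (k + 1)) ≠ 0 := by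
    rw [ae_all_iff]
    intro n
    rw [ae_all_iff]
    intro v
    by_cases h0 : (if ext n v 0 = x₀ then (1 : ℝ) else 0) *
        ∏ k ∈ Finset.range n, embeddedMatrix Q (ext n v k) (ext n v (k + 1)) = 0
    · have hm := h.chain_law n (ext n v)
      rw [h0, measureReal_eq_zero_iff] at hm
      have : ∀ᵐ ω ∂P, ¬ ∀ k ≤ n, Z k ω = ext n v k := by
        rw [ae_iff]
        simpa using hm
      filter_upwards [this] with ω hω hω'
      exact absurd hω' hω
    · exact Eventually.of_forall fun _ _ => h0
  filter_upwards [hcyl] with ω hω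
  have hgood : ∀ n, (if Z 0 ω = x₀ then (1 : ℝ) else 0) *
      ∏ k ∈ Finset.range n, embeddedMatrix Q (Z k ω) (Z (k + 1) ω) ≠ 0 := by
    intro n
    have hext : ∀ k ≤ n, Z k ω = ext n (fun i => Z i ω) k := fun k hk => by simp [ext, hk]
    have := hω n (fun i => Z i ω) hext
    rw [← hext 0 n.zero_le, Finset.prod_congr rfl fun k hk => by
      rw [← hext k (Finset.mem_range.1 hk).le, ← hext (k + 1) (Finset.mem_range.1 hk)]] at this
    exact this
  refine ⟨?_, fun n => ?_⟩
  · by_contra hne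
    exact hgood 0 (by simp [hne])
  · have := right_ne_zero_of_mul (hgood (n + 1))
    exact Finset.prod_ne_zero_iff.1 this n (by simp)

end jumpHold

/-! ### The machine without sampling -/

section noSampling

variable {α β γ lam : ℝ}

lemma exitRate_monGen_zero :
    exitRate (monGen α β γ lam 0) s00 = α + lam ∧ exitRate (monGen α β γ lam 0) s10 = β + lam ∧
    exitRate (monGen α β γ lam 0) s01 = α ∧ exitRate (monGen α β γ lam 0) s11 = β ∧
    exitRate (monGen α β γ lam 0) s02 = α ∧ exitRate (monGen α β γ lam 0) s12 = β ∧
    exitRate (monGen α β γ lam 0) s22 = γ := by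
  simp only [monGen, exitRate_generatorOf, sum_monState]
  simp [monRate, s00, s10, s01, s11, s02, s12, s22]

lemma exitRate_monGen_zero_pos (hα : 0 < α) (hβ : 0 < β) (hγ : 0 < γ) (hlam : 0 < lam)
    (i : MonState) : 0 < exitRate (monGen α β γ lam 0) i := by
  revert i
  rw [forall_monState]
  obtain ⟨h1, h2, h3, h4, h5, h6, h7⟩ := exitRate_monGen_zero (α := α) (β := β) (γ := γ) (lam := lam)
  rw [h1, h2, h3, h4, h5, h6, h7]
  refine ⟨?_, ?_, ?_, ?_, ?_, ?_, ?_⟩ <;> positivity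

/-- The transitions that are possible without sampling. -/
def MonStep (i j : MonState) : Prop :=
  (i.1.1 = 0 ∧ j.1 = (1, i.1.2)) ∨ (i.1.1 = 1 ∧ j.1 = (0, i.1.2)) ∨
  (i.1.1 = 2 ∧ j.1 = (0, i.1.2)) ∨
  (i.1.2 = 0 ∧ j.1 = (if i.1.1 = 0 then (2, 2) else (i.1.1, i.1.1)))

instance : DecidableRel MonStep := fun i j => by unfold MonStep; infer_instance

/-- Removes the rates: `MonStep` is a decidable relation on seven states, so the path arguments
below reduce to `decide`. -/
lemma monStep_of_embeddedMatrix_ne_zero (hα : 0 < α) (hβ : 0 < β) (hγ : 0 < γ) (hlam : 0 < lam)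
    {i j : MonState} (h : embeddedMatrix (monGen α β γ lam 0) i j ≠ 0) : MonStep i j := by
  have hne := (exitRate_monGen_zero_pos hα hβ hγ hlam i).ne'
  rw [embeddedMatrix, if_neg hne] at h
  have hij : i ≠ j := fun hij => h (if_pos hij)
  rw [if_neg hij, monGen, generatorOf_apply_ne _ hij] at h
  by_contra hs
  simp only [MonStep, not_or] at hs
  obtain ⟨h1, h2, h3, h4⟩ := hs
  exact h (by rw [monRate, if_neg h1, if_neg h2, if_neg h3, if_neg h4, ite_self]; simp)

lemma embeddedMatrix_monGen_zero (hα : 0 < α) (hβ : 0 < β) (hlam : 0 < lam) :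
    embeddedMatrix (monGen α β γ lam 0) s00 s10 = α / (α + lam) ∧
    embeddedMatrix (monGen α β γ lam 0) s00 s22 = lam / (α + lam) ∧
    embeddedMatrix (monGen α β γ lam 0) s10 s00 = β / (β + lam) ∧
    embeddedMatrix (monGen α β γ lam 0) s10 s11 = lam / (β + lam) := by
  obtain ⟨h1, h2, -⟩ := exitRate_monGen_zero (α := α) (β := β) (γ := γ) (lam := lam)
  have h3 : α + lam ≠ 0 := by positivity
  have h4 : β + lam ≠ 0 := by positivity
  simp only [embeddedMatrix, h1, h2, h3, h4, if_false]
  simp [monGen, generatorOf, monRate, s00, s10, s11, s22]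

lemma alternating_of_monStep {z : ℕ → MonState} (hz : ∀ n, MonStep (z n) (z (n + 1)))
    {a b : MonState} (hab : ∀ j, MonStep a j → j = b) (hba : ∀ j, MonStep b j → j = a) {N : ℕ}
    (hN : z N = a) (k : ℕ) : z (N + k) = if Even k then a else b := by
  induction k with
  | zero => simpa using hN
  | succ k ih =>
    have h := hz (N + k)
    rw [ih] at h
    by_cases hk : Even k
    · rw [if_pos hk] at h
      rw [if_neg (by simpa [Nat.even_add_one] using hk)]
      exact hab _ h
    · rw [if_neg hk] at h
      rw [if_pos (by simpa [Nat.even_add_one] using hk)]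
      exact hba _ h

lemma eventually_alternating_of_exit {z : ℕ → MonState} (hz : ∀ n, MonStep (z n) (z (n + 1)))
    {n : ℕ} (hn : z n = s22 ∨ z n = s11) :
    ∃ N, (∀ k, z (N + k) = if Even k then s12 else s02) ∨
      (∀ k, z (N + k) = if Even k then s11 else s01) := by
  rcases hn with hn | hn
  · have h1 : z (n + 1) = s02 := by
      have h := hz n
      rw [hn] at h
      revert h
      generalize z (n + 1) = j
      revert j
      decide
    have h2 : z (n + 2) = s12 := by
      have h := hz (n + 1)
      rw [h1] at h
      revert h
      generalize z (n + 1 + 1) = j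
      revert j
      decide
    -- Two more jumps lead from (2,2) through (0,2) to (1,2), so that in both classes the
    -- alternation starts at the fresh state.
    exact ⟨n + 2, Or.inl (alternating_of_monStep hz (by decide) (by decide) h2)⟩
  · exact ⟨n, Or.inr (alternating_of_monStep hz (by decide) (by decide) hn)⟩

/-- The sequence of states of the embedded chain as long as it stays in `{(0,0), (1,0)}`. -/
def pairChain (k : ℕ) : MonState := if Even k then s00 else s10

/-- Inside the pair the only possible path is the alternating one, so the first deviation from
`pairChain` is the exit. -/
lemma exists_exit_of_ne_pairChain {z : ℕ → MonState} (h0 : z 0 = s00)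
    (hz : ∀ n, MonStep (z n) (z (n + 1))) (hne : ∃ k, z k ≠ pairChain k) :
    ∃ n, (∀ k ≤ n, z k = pairChain k) ∧
      ((z n = s00 ∧ z (n + 1) = s22) ∨ (z n = s10 ∧ z (n + 1) = s11)) := by
  classical
  have hspec := Nat.find_spec hne
  have hmin : ∀ k < Nat.find hne, z k = pairChain k := fun k hk => not_not.1 (Nat.find_min hne hk)
  obtain ⟨n, hn⟩ : ∃ n, Nat.find hne = n + 1 := by
    refine Nat.exists_eq_succ_of_ne_zero fun h => ?_
    rw [h] at hspec
    exact hspec (by simpa [pairChain] using h0)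
  rw [hn] at hspec hmin
  refine ⟨n, fun k hk => hmin k (by omega), ?_⟩
  have hzn := hmin n n.lt_succ_self
  have hs := hz n
  unfold pairChain at hzn hspec
  by_cases hp : Even n
  · rw [if_pos hp] at hzn
    rw [if_neg (by simpa [Nat.even_add_one] using hp)] at hspec
    rw [hzn] at hs
    refine Or.inl ⟨hzn, ?_⟩
    revert hs hspec
    generalize z (n + 1) = j
    revert j
    decide
  · rw [if_neg hp] at hzn
    rw [if_pos (by simpa [Nat.even_add_one] using hp)] at hspec
    rw [hzn] at hs
    refine Or.inr ⟨hzn, ?_⟩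
    revert hs hspec
    generalize z (n + 1) = j
    revert j
    decide

lemma prod_embeddedMatrix_pairChain (hα : 0 < α) (hβ : 0 < β) (hlam : 0 < lam) (n : ℕ) :
    ∏ k ∈ Finset.range (2 * n),
      embeddedMatrix (monGen α β γ lam 0) (pairChain k) (pairChain (k + 1)) =
      (α / (α + lam) * (β / (β + lam))) ^ n := by
  obtain ⟨h1, -, h2, -⟩ := embeddedMatrix_monGen_zero (γ := γ) hα hβ hlam
  induction n with
  | zero => simp
  | succ n ih =>
    rw [mul_add_one, Finset.prod_range_succ, Finset.prod_range_succ, ih, pow_succ, mul_assoc]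
    congr 1
    simp [pairChain, Nat.even_add_one, h1, h2]

/-! ### Exit from the transient pair and the resulting freshness -/

variable {Ω : Type*} [MeasurableSpace Ω] {P : Measure Ω}
  {Z : ℕ → Ω → MonState} {E : ℕ → Ω → ℝ} {Y : ℝ → Ω → MonState}

lemma IsJumpHold.ae_mem_exitsFrom (hα : 0 < α) (hβ : 0 < β) (hγ : 0 < γ) (hlam : 0 < lam)
    (h : IsJumpHold P (monGen α β γ lam 0) s00 Z E Y) :
    ∀ᵐ ω ∂P, ∀ n, (∀ k ≤ n, Z k ω ∈ ({s00, s10} : Set MonState)) →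
      Z (n + 1) ω ∉ ({s00, s10} : Set MonState) → ω ∈ exitsFrom {s00, s10} Y (Z n ω) := by
  filter_upwards [h.path, ae_clock_pos h.measurable_clock h.clock_law] with ω hpath hE n hD hexit
  exact mem_exitsFrom_of_chain (exitRate_monGen_zero_pos hα hβ hγ hlam) hE hpath hD hexit

/-- A path of the embedded chain of positive probability that leaves the pair gives an exit of
positive probability. -/
lemma IsJumpHold.exitsFrom_pos_of_path (hα : 0 < α) (hβ : 0 < β) (hγ : 0 < γ) (hlam : 0 < lam)
    (h : IsJumpHold P (monGen α β γ lam 0) s00 Z E Y) {n : ℕ} {z : ℕ → MonState} (h0 : z 0 = s00)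
    (hD : ∀ k ≤ n, z k ∈ ({s00, s10} : Set MonState))
    (hexit : z (n + 1) ∉ ({s00, s10} : Set MonState))
    (hz : 0 < ∏ k ∈ Finset.range (n + 1),
      embeddedMatrix (monGen α β γ lam 0) (z k) (z (k + 1))) :
    0 < P (exitsFrom {s00, s10} Y (z n)) := by
  have hlaw := h.chain_law (n + 1) z
  rw [if_pos h0, one_mul] at hlaw
  rw [← hlaw, measureReal_def, ENNReal.toReal_pos_iff] at hz
  -- Almost sure inclusion suffices, so the exit event need not be shown measurable.
  refine hz.1.trans_le (measure_mono_ae ?_)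
  filter_upwards [h.ae_mem_exitsFrom hα hβ hγ hlam] with ω hmem
  intro (hω : ∀ k ≤ n + 1, Z k ω = z k)
  have := hmem n (fun k hk => hω k (by omega) ▸ hD k hk) (hω _ le_rfl ▸ hexit)
  rwa [hω n (by omega)] at this

lemma s11_notMem_pair : s11 ∉ ({s00, s10} : Set MonState) := by
  simp [s11, s00, s10]

lemma s22_notMem_pair : s22 ∉ ({s00, s10} : Set MonState) := by
  simp [s22, s00, s10]

lemma IsJumpHold.exitsFrom_pair_pos (hα : 0 < α) (hβ : 0 < β) (hγ : 0 < γ) (hlam : 0 < lam)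
    (h : IsJumpHold P (monGen α β γ lam 0) s00 Z E Y) {s : MonState}
    (hs : s ∈ ({s00, s10} : Set MonState)) : 0 < P (exitsFrom {s00, s10} Y s) := by
  obtain ⟨e1, e2, -, e4⟩ := embeddedMatrix_monGen_zero (γ := γ) hα hβ hlam
  rcases hs with rfl | rfl
  -- The shortest exit paths are used: (0,0), (2,2) here, and (0,0), (1,0), (1,1) for the other
  -- state.
  · refine h.exitsFrom_pos_of_path hα hβ hγ hlam (n := 0)
      (z := fun k => if k = 0 then s00 else s22) rfl (by simp) (by simpa using s22_notMem_pair) ?_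
    simp only [zero_add, Finset.prod_range_one, if_true, one_ne_zero, if_false, e2]
    positivity
  · refine h.exitsFrom_pos_of_path hα hβ hγ hlam (n := 1)
      (z := fun k => if k = 0 then s00 else if k = 1 then s10 else s11) rfl ?_
      (by simpa using s11_notMem_pair) ?_
    · intro k hk
      interval_cases k <;> simp
    · simp only [Finset.prod_range_succ, Finset.prod_range_zero, one_mul]
      norm_num [e1, e4]
      positivity

variable [IsProbabilityMeasure P]

/-- Staying in the pair forever entails `n` round trips for every `n`, which has geometrically small
probability. -/
lemma IsJumpHold.ae_ne_pairChain (hα : 0 < α) (hβ : 0 < β) (hlam : 0 < lam)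
    (h : IsJumpHold P (monGen α β γ lam 0) s00 Z E Y) :
    ∀ᵐ ω ∂P, ∃ k, Z k ω ≠ pairChain k := by
  have hle : ∀ n : ℕ, P.real {ω | ∀ k, Z k ω = pairChain k} ≤
      (α / (α + lam) * (β / (β + lam))) ^ n := by
    intro n
    rw [← prod_embeddedMatrix_pairChain (γ := γ) hα hβ hlam]
    have hlaw := h.chain_law (2 * n) pairChain
    rw [if_pos (by simp [pairChain]), one_mul] at hlaw
    rw [← hlaw]
    exact measureReal_mono fun ω hω k _ => hω k
  have hlt : α / (α + lam) * (β / (β + lam)) < 1 := by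
    refine mul_lt_one_of_nonneg_of_lt_one_left (by positivity) ?_ ?_
    · rw [div_lt_one (by positivity)]; linarith
    · rw [div_le_one (by positivity)]; linarith
  have hzero : P.real {ω | ∀ k, Z k ω = pairChain k} = 0 :=
    le_antisymm (ge_of_tendsto' (tendsto_pow_atTop_nhds_zero_of_lt_one (by positivity) hlt) hle)
      measureReal_nonneg
  rw [measureReal_eq_zero_iff] at hzero
  rw [ae_iff]
  simpa using hzero

/-- Almost surely the chain leaves the pair, and its freshness is that of the class it enters. -/
lemma IsJumpHold.ae_exit_and_freshness (hα : 0 < α) (hβ : 0 < β) (hγ : 0 < γ) (hlam : 0 < lam)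
    (h : IsJumpHold P (monGen α β γ lam 0) s00 Z E Y) :
    ∀ᵐ ω ∂P, (∃ n, (∀ k ≤ n, Z k ω = pairChain k) ∧
      ((Z n ω = s00 ∧ Z (n + 1) ω = s22) ∨ (Z n ω = s10 ∧ Z (n + 1) ω = s11))) ∧
      freshness specialMap Y ω = α / (α + β) := by
  have hQ := exitRate_monGen_zero_pos hα hβ hγ hlam
  filter_upwards [h.ae_chain, h.ae_ne_pairChain hα hβ hlam, h.path,
    ae_clock_pos h.measurable_clock h.clock_law,
    ae_tendsto_clock_average h.measurable_clock h.clock_law h.clock_indep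
      (g := fun i => 2 * i) (fun i j hij => by simpa using hij),
    ae_tendsto_clock_average h.measurable_clock h.clock_law h.clock_indep
      (g := fun i => 2 * i + 1) (fun i j hij => by simpa using hij)]
    with ω hchain hne hpath hE he ho
  have hz : ∀ n, MonStep (Z n ω) (Z (n + 1) ω) :=
    fun n => monStep_of_embeddedMatrix_ne_zero hα hβ hγ hlam (hchain.2 n)
  obtain ⟨n, hn, hexit⟩ := exists_exit_of_ne_pairChain hchain.1 hz hne
  refine ⟨⟨n, hn, hexit⟩, ?_⟩
  have hC : ∀ i, 0 ≤ specialMap i := fun i => by unfold specialMap; split_ifs <;> norm_num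
  obtain ⟨-, -, r1, r2, r3, r4, -⟩ := exitRate_monGen_zero (α := α) (β := β) (γ := γ) (lam := lam)
  have c1 : specialMap s01 = 0 := by simp [specialMap, s01]
  have c2 : specialMap s11 = 1 := by simp [specialMap, s11]
  have c3 : specialMap s02 = 0 := by simp [specialMap, s02]
  have c4 : specialMap s12 = 1 := by simp [specialMap, s12]
  obtain ⟨N, hN | hN⟩ := eventually_alternating_of_exit hz (n := n + 1)
    (hexit.imp And.right And.right)
  · rw [freshness_eq_of_alternating hQ hE hpath he ho hC hN, r3, r4, c3, c4]
    field_simp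
    ring
  · rw [freshness_eq_of_alternating hQ hE hpath he ho hC hN, r1, r2, c1, c2]
    field_simp
    ring

lemma pairChain_mem_pair (k : ℕ) : pairChain k ∈ ({s00, s10} : Set MonState) := by
  unfold pairChain
  split_ifs <;> simp

lemma IsJumpHold.ae_exits_pair (hα : 0 < α) (hβ : 0 < β) (hγ : 0 < γ) (hlam : 0 < lam)
    (h : IsJumpHold P (monGen α β γ lam 0) s00 Z E Y) :
    ∀ᵐ ω ∂P, ω ∈ exitsFrom {s00, s10} Y s00 ∪ exitsFrom {s00, s10} Y s10 := by
  filter_upwards [h.ae_exit_and_freshness hα hβ hγ hlam, h.ae_mem_exitsFrom hα hβ hγ hlam]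
    with ω ⟨⟨n, hn, hexit⟩, _⟩ hmem
  have := hmem n fun k hk => hn k hk ▸ pairChain_mem_pair k
  rcases hexit with ⟨h1, h2⟩ | ⟨h1, h2⟩ <;> rw [h1, h2] at this
  · exact Or.inl (this s22_notMem_pair)
  · exact Or.inr (this s11_notMem_pair)

end noSampling

theorem theorem3 {Ω : Type*} [MeasurableSpace Ω] (P : Measure Ω) [IsProbabilityMeasure P]
    (α β γ lam : ℝ) (hα : 0 < α) (hβ : 0 < β) (hγ : 0 < γ) (hlam : 0 < lam)
    (Y : ℝ → Ω → MonState) (hY : IsCTMC P (monGen α β γ lam 0) s00 Y) :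
    -- for `μ > 0` the stationary distribution exists and is unique
    (∀ μ : ℝ, 0 < μ → ∃! π : MonState → ℝ, IsStationaryDistr (monGen α β γ lam μ) π) ∧
    -- the average freshness at `μ = 0` is the limit of the formula for `μ > 0`
    Integrable (freshness specialMap Y) P ∧
    (∀ π : ℝ → MonState → ℝ, (∀ μ, 0 < μ → IsStationaryDistr (monGen α β γ lam μ) (π μ)) →
      Tendsto (fun μ => 1 - (π μ s10 + π μ s01 + π μ s02)) (𝓝[>] 0)
        (𝓝 (avgFreshness P specialMap Y))) ∧
    -- its value
    avgFreshness P specialMap Y = α / (α + β) ∧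
    -- the chain leaves the pair `(0,0), (1,0)`, and the value does not depend on the exit state
    (∀ᵐ ω ∂P, ω ∈ exitsFrom {s00, s10} Y s00 ∪ exitsFrom {s00, s10} Y s10) ∧
    (∀ s ∈ ({s00, s10} : Set MonState),
      0 < P (exitsFrom {s00, s10} Y s) ∧
      avgFreshness (ProbabilityTheory.cond P (exitsFrom {s00, s10} Y s)) specialMap Y
        = α / (α + β)) := by
  obtain ⟨-, Z, E, h⟩ := hY
  have hfresh : freshness specialMap Y =ᵐ[P] fun _ => α / (α + β) :=
    (h.ae_exit_and_freshness hα hβ hγ hlam).mono fun _ hω => hω.2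
  have havg : avgFreshness P specialMap Y = α / (α + β) := by
    rw [avgFreshness, integral_congr_ae hfresh]
    simp
  refine ⟨fun μ hμ => existsUnique_isStationaryDistr_monGen hα hβ hγ hlam hμ,
    (integrable_const _).congr hfresh.symm, fun π hπ => ?_, havg, h.ae_exits_pair hα hβ hγ hlam,
    fun s hs => ?_⟩
  · rw [havg]
    exact tendsto_stationary_freshness hα hβ hγ hlam hπ
  · have hpos := h.exitsFrom_pair_pos hα hβ hγ hlam hs
    refine ⟨hpos, ?_⟩
    -- Positivity matters: conditioning on a null event would give the zero measure. The conditional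
    -- law is absolutely continuous, so Δ keeps its almost sure value.
    have := cond_isProbabilityMeasure hpos.ne'
    rw [avgFreshness, integral_congr_ae (cond_absolutelyContinuous.ae_le hfresh)]
    simp
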